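/- For complex $q$ with $|q|<1$ put $$E_2(q)=1-24\sum_{k\ge 1}\frac{k\,q^k}{1-q^k},$$ and for $q=e^{t}$ with $\operatorname{Re} t<0$ (so that $q^{a}:=e^{at}$ for every rational $a$) put $$\theta_2(q)=2\sum_{k\ge 0}q^{\frac12\left(k+\frac12\right)^2},\qquad \theta_3(q)=1+2\sum_{k\ge1}q^{\frac{k^2}{2}},$$ where $\theta_j(q^{a})$ is the value of this series at $e^{at}$, computed with $at$ in place of $t$. All these series converge absolutely. Put further $$f_0(q)=-\tfrac1{48}\bigl(E_2(q)-E_2(-q)\bigr),\quad f_1(q)=-\tfrac1{24}E_2(q^4),\quad f_2(q)=-\tfrac1{24}E_2(q)-f_0(q)-f_1(q),$$ $$x(q)=\theta_3(q^8)^2,\quad y(q)=\theta_2(q^8)^2,\quad w(q)=\tfrac13\bigl(E_2(q^4)-2E_2(q^8)+4E_2(q^{16})\bigr).$$ Then for every $t\in\mathbb C$ with $\operatorname{Re}t<0$ and $q=e^t$ the following identities hold. (a) (Identities arising from the pair $(\widetilde E_7,G^D)$.) $$\tfrac14 f_1(q^4)=\tfrac1{384}\bigl(-3w(q)-x(q)^2-y(q)^2\bigr),\qquad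 f_0(q^4)=\tfrac1{16}\,y(q)^2,\qquad f_2(q^4)=\tfrac{3}{32}\bigl(-w(q)+x(q)^2-y(q)^2\bigr),$$ $$E_2(q)-E_2(-q)=-3\,\theta_2(q^2)^4,\qquad E_2(q^2)=\tfrac12E_2(q)+\tfrac12\theta_2(q^2)^4+\tfrac12\theta_3(q^2)^4.$$ (b) (Identities arising from the pair $(\widetilde E_7,K_2)$.) $$\theta_2(q^{16})^2+\theta_3(q^{16})^2=\theta_3(q^8)^2,\qquad \theta_2(q^8)^5=4\,\theta_2(q^8)\,\theta_2(q^{16})^2\,\theta_3(q^{16})^2,\qquad \theta_2(q^8)^4=4\,\theta_2(q^{16})^2\,\theta_3(q^{16})^2.$$ -/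

import Mathlib

/-! `q`-series are written in the variable `t` with `q = exp t`, `Re t < 0`, so that `|q| < 1` and
a power `q ^ a` with rational exponent `a` means `exp (a * t)`. -/

namespace QuasimodularIdentities

noncomputable section

/-- The Eisenstein series `E₂(q) = 1 - 24 ∑_{k ≥ 1} k q^k / (1 - q^k)`, as a function of `q`. -/
def E2 (q : ℂ) : ℂ :=
  1 - 24 * ∑' k : ℕ+, (k : ℂ) * q ^ (k : ℕ) / (1 - q ^ (k : ℕ))

/-- The theta constant `θ₂(q) = 2 ∑_{k ≥ 0} q^{(k + 1/2)² / 2}` for `q = exp t`;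
thus `θ₂(q^a)` is `theta2 (a * t)`. -/
def theta2 (t : ℂ) : ℂ :=
  2 * ∑' k : ℕ, Complex.exp ((1 / 2 : ℂ) * ((k : ℂ) + 1 / 2) ^ 2 * t)

/-- The theta constant `θ₃(q) = 1 + 2 ∑_{k ≥ 1} q^{k² / 2}` for `q = exp t`;
thus `θ₃(q^a)` is `theta3 (a * t)`. -/
def theta3 (t : ℂ) : ℂ :=
  1 + 2 * ∑' k : ℕ+, Complex.exp ((k : ℂ) ^ 2 / 2 * t)

/-- `f₀(q) = -(E₂(q) - E₂(-q)) / 48`. -/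
def f0 (q : ℂ) : ℂ := -(1 / 48 : ℂ) * (E2 q - E2 (-q))

/-- `f₁(q) = -E₂(q⁴) / 24`. -/
def f1 (q : ℂ) : ℂ := -(1 / 24 : ℂ) * E2 (q ^ 4)

/-- `f₂(q) = -E₂(q) / 24 - f₀(q) - f₁(q)`. -/
def f2 (q : ℂ) : ℂ := -(1 / 24 : ℂ) * E2 q - f0 q - f1 q

/-- `x = θ₃(q⁸)²` for `q = exp t`. -/
def xFun (t : ℂ) : ℂ := theta3 (8 * t) ^ 2

/-- `y = θ₂(q⁸)²` for `q = exp t`. -/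
def yFun (t : ℂ) : ℂ := theta2 (8 * t) ^ 2

/-- `w = (E₂(q⁴) - 2 E₂(q⁸) + 4 E₂(q¹⁶)) / 3`. -/
def wFun (q : ℂ) : ℂ := (1 / 3 : ℂ) * (E2 (q ^ 4) - 2 * E2 (q ^ 8) + 4 * E2 (q ^ 16))

end

end QuasimodularIdentities

namespace QuasimodularIdentities

open Complex Filter Topology
open scoped Real

/-! Every identity is a polynomial consequence of two kinds of facts: the doubling formulas for
squares of theta constants, and linear expressions of θ₂⁴, θ₃⁴ in values of E₂ (with `E2_add_E2_neg`
to eliminate E₂(-q)).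

The doubling formulas come from splitting ℤ × ℤ by parity (`tsum_mul_tsum_parity`), and they yield
Jacobi's quartic identity.

For the fourth powers, let D and D' be the differences between θ₃⁴, θ₄⁴ and their expected
Eisenstein expressions. Translation by 1 swaps them; z ↦ -1/z sends (D, D') to -z²(D, D - D'). Hence
D² - DD' + D'² is invariant of weight 4 for the full modular group and tends to 0 at i∞, so it
vanishes, since there are no nonzero level-one cusp forms of weight below 12. The form splits into
linear factors over ℂ, so D = wD' for a constant w with w² - w + 1 = 0; translating by 1 then forces
D = D' = 0. -/

/-! ### Doubling formulas for theta constants. -/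

/-- The substitution `(m, n) = (i + j, i - j)` or `(i + j + 1, i - j)` in a sum over `ℤ × ℤ`. -/
def intProdParityEquiv : (ℤ × ℤ) ⊕ (ℤ × ℤ) ≃ ℤ × ℤ where
  toFun := Sum.elim (fun p => (p.1 + p.2, p.1 - p.2)) (fun p => (p.1 + p.2 + 1, p.1 - p.2))
  invFun p := if (p.1 + p.2) % 2 = 0 then .inl ((p.1 + p.2) / 2, (p.1 - p.2) / 2)
    else .inr ((p.1 + p.2) / 2, (p.1 - p.2) / 2)
  left_inv := by
    rintro (⟨i, j⟩ | ⟨i, j⟩)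
    · have h : (i + j + (i - j)) % 2 = 0 := by omega
      simp only [Sum.elim_inl, h, if_true, Sum.inl.injEq, Prod.mk.injEq]
      omega
    · have h : ¬ (i + j + 1 + (i - j)) % 2 = 0 := by omega
      simp only [Sum.elim_inr, h, if_false, Sum.inr.injEq, Prod.mk.injEq]
      omega
  right_inv := by
    rintro ⟨m, n⟩
    by_cases h : (m + n) % 2 = 0
    · simp only [h, if_true, Sum.elim_inl, Prod.mk.injEq]
      omega
    · simp only [h, if_false, Sum.elim_inr, Prod.mk.injEq]
      omega

/-- Since (i + j)² + (i - j)² = 2i² + 2j², this change of variables separates a product of two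
Gaussian sums into products with doubled argument. -/
theorem tsum_mul_tsum_parity {f g f₁ g₁ f₂ g₂ : ℤ → ℂ} {c₁ c₂ : ℂ} (hf : Summable f)
    (hg : Summable g) (hf₁ : Summable f₁) (hg₁ : Summable g₁) (hf₂ : Summable f₂)
    (hg₂ : Summable g₂)
    (h₁ : ∀ i j, f (i + j) * g (i - j) = c₁ * (f₁ i * g₁ j))
    (h₂ : ∀ i j, f (i + j + 1) * g (i - j) = c₂ * (f₂ i * g₂ j)) :
    (∑' n, f n) * ∑' n, g n =
      c₁ * ((∑' n, f₁ n) * ∑' n, g₁ n) + c₂ * ((∑' n, f₂ n) * ∑' n, g₂ n) := by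
  have hfg := summable_mul_of_summable_norm hf.norm hg.norm
  have hfg₁ := summable_mul_of_summable_norm hf₁.norm hg₁.norm
  have hfg₂ := summable_mul_of_summable_norm hf₂.norm hg₂.norm
  rw [tsum_mul_tsum_of_summable_norm hf.norm hg.norm,
    tsum_mul_tsum_of_summable_norm hf₁.norm hg₁.norm,
    tsum_mul_tsum_of_summable_norm hf₂.norm hg₂.norm, ← tsum_mul_left, ← tsum_mul_left,
    ← intProdParityEquiv.tsum_eq, Summable.tsum_sum]
  · congr 1
    · exact tsum_congr fun p => h₁ p.1 p.2
    · exact tsum_congr fun p => h₂ p.1 p.2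
  · exact (hfg₁.mul_left c₁).congr fun p => (h₁ p.1 p.2).symm
  · exact (hfg₂.mul_left c₂).congr fun p => (h₂ p.1 p.2).symm

/-- The theta constant `∑_{n ∈ ℤ} exp (π i (n + 1/2)² z)`. -/
noncomputable def thetaTwo (z : ℂ) : ℂ := ∑' n : ℤ, cexp (π * I * ((n : ℂ) + 1 / 2) ^ 2 * z)

/-- The theta constant `∑_{n ∈ ℤ} (-1)ⁿ exp (π i n² z)`. -/
noncomputable def thetaFour (z : ℂ) : ℂ := jacobiTheta₂ (1 / 2) z

theorem thetaTwo_term_eq (n : ℤ) (z : ℂ) : cexp (π * I * ((n : ℂ) + 1 / 2) ^ 2 * z) =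
    cexp (π * I * z / 4) * jacobiTheta₂_term n (z / 2) z := by
  rw [jacobiTheta₂_term, ← Complex.exp_add]
  ring_nf

theorem summable_jacobiTheta_term {z : ℂ} (hz : 0 < z.im) :
    Summable fun n : ℤ => cexp (π * I * (n : ℂ) ^ 2 * z) :=
  ((summable_jacobiTheta₂_term_iff 0 z).2 hz).congr fun n => by simp [jacobiTheta₂_term]

theorem summable_thetaTwo_term {z : ℂ} (hz : 0 < z.im) :
    Summable fun n : ℤ => cexp (π * I * ((n : ℂ) + 1 / 2) ^ 2 * z) :=
  (((summable_jacobiTheta₂_term_iff (z / 2) z).2 hz).mul_left (cexp (π * I * z / 4))).congr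
    fun n => (thetaTwo_term_eq n z).symm

theorem thetaTwo_eq (z : ℂ) : thetaTwo z = cexp (π * I * z / 4) * jacobiTheta₂ (z / 2) z := by
  rw [thetaTwo, jacobiTheta₂, ← tsum_mul_left]
  exact tsum_congr fun n => thetaTwo_term_eq n z

theorem jacobiTheta_sq {z : ℂ} (hz : 0 < z.im) :
    jacobiTheta z ^ 2 = jacobiTheta (2 * z) ^ 2 + thetaTwo (2 * z) ^ 2 := by
  have hz2 : 0 < (2 * z).im := by simpa using hz
  have := tsum_mul_tsum_parity (c₁ := 1) (c₂ := 1) (summable_jacobiTheta_term hz)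
    (summable_jacobiTheta_term hz) (summable_jacobiTheta_term hz2) (summable_jacobiTheta_term hz2)
    (summable_thetaTwo_term hz2) (summable_thetaTwo_term hz2)
    (fun i j => by
      simp only [one_mul, ← Complex.exp_add]; push_cast; ring_nf)
    (fun i j => by
      simp only [one_mul, ← Complex.exp_add]; push_cast; ring_nf)
  rw [one_mul, one_mul] at this
  simpa only [sq, jacobiTheta, thetaTwo] using this

theorem jacobiTheta₂_half_term (n : ℤ) (z : ℂ) : jacobiTheta₂_term n (1 / 2) z =
    (-1) ^ n * cexp (π * I * (n : ℂ) ^ 2 * z) := by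
  rw [jacobiTheta₂_term, Complex.exp_add, ← Complex.exp_pi_mul_I, ← Complex.exp_int_mul]
  ring_nf

theorem thetaFour_sq {z : ℂ} (hz : 0 < z.im) :
    thetaFour z ^ 2 = jacobiTheta (2 * z) ^ 2 - thetaTwo (2 * z) ^ 2 := by
  have hz2 : 0 < (2 * z).im := by simpa using hz
  have hs : Summable fun n : ℤ => (-1 : ℂ) ^ n * cexp (π * I * (n : ℂ) ^ 2 * z) :=
    ((summable_jacobiTheta₂_term_iff (1 / 2) z).2 hz).congr fun n => jacobiTheta₂_half_term n z
  have h1 (i : ℤ) : (-1 : ℂ) ^ i * (-1) ^ i = 1 := by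
    rw [← mul_zpow]; simp
  have := tsum_mul_tsum_parity (c₁ := 1) (c₂ := -1) hs hs
    (summable_jacobiTheta_term hz2) (summable_jacobiTheta_term hz2)
    (summable_thetaTwo_term hz2) (summable_thetaTwo_term hz2)
    (fun i j => by
      rw [mul_mul_mul_comm, ← zpow_add₀ (by simp), show i + j + (i - j) = i + i by ring,
        zpow_add₀ (by simp), h1]
      simp only [one_mul, ← Complex.exp_add]; push_cast; ring_nf)
    (fun i j => by
      rw [mul_mul_mul_comm, ← zpow_add₀ (by simp), show i + j + 1 + (i - j) = i + i + 1 by ring,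
        zpow_add₀ (by simp), zpow_add₀ (by simp), h1]
      simp only [one_mul, zpow_one, ← Complex.exp_add]; push_cast; ring_nf)
  rw [sq, thetaFour, jacobiTheta₂, tsum_congr fun n => jacobiTheta₂_half_term n z, this,
    jacobiTheta, thetaTwo]
  ring

theorem thetaTwo_sq {z : ℂ} (hz : 0 < z.im) :
    thetaTwo z ^ 2 = 2 * (jacobiTheta (2 * z) * thetaTwo (2 * z)) := by
  have hz2 : 0 < (2 * z).im := by simpa using hz
  have hs : Summable fun n : ℤ => cexp (π * I * ((n : ℂ) + 1) ^ 2 * (2 * z)) :=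
    ((Equiv.addRight (1 : ℤ)).summable_iff.2 (summable_jacobiTheta_term hz2)).congr
      fun n => by simp
  have := tsum_mul_tsum_parity (c₁ := 1) (c₂ := 1) (summable_thetaTwo_term hz)
    (summable_thetaTwo_term hz) (summable_thetaTwo_term hz2) (summable_jacobiTheta_term hz2)
    hs (summable_thetaTwo_term hz2)
    (fun i j => by
      simp only [one_mul, ← Complex.exp_add]; push_cast; ring_nf)
    (fun i j => by
      simp only [one_mul, ← Complex.exp_add]; push_cast; ring_nf)
  have hshift : ∑' n : ℤ, cexp (π * I * ((n : ℂ) + 1) ^ 2 * (2 * z)) = jacobiTheta (2 * z) :=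
    (tsum_congr fun n => by simp).trans ((Equiv.addRight (1 : ℤ)).tsum_eq
      fun n : ℤ => cexp (π * I * (n : ℂ) ^ 2 * (2 * z)))
  rw [hshift] at this
  rw [sq, thetaTwo, this, ← jacobiTheta, ← thetaTwo]
  ring

/-- Jacobi's quartic identity. -/
theorem jacobiTheta_pow_four {z : ℂ} (hz : 0 < z.im) :
    jacobiTheta z ^ 4 = thetaTwo z ^ 4 + thetaFour z ^ 4 := by
  have h1 := jacobiTheta_sq hz
  have h2 := thetaTwo_sq hz
  have h3 := thetaFour_sq hz
  rw [show jacobiTheta z ^ 4 = (jacobiTheta z ^ 2) ^ 2 by ring,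
    show thetaTwo z ^ 4 = (thetaTwo z ^ 2) ^ 2 by ring,
    show thetaFour z ^ 4 = (thetaFour z ^ 2) ^ 2 by ring, h1, h2, h3]
  ring

/-! ### Modular transformations, limits at i∞ and q-series of theta constants. -/

theorem jacobiTheta_add_one (z : ℂ) : jacobiTheta (z + 1) = thetaFour z := by
  rw [thetaFour, jacobiTheta₂, jacobiTheta]
  refine tsum_congr fun n => ?_
  rw [jacobiTheta₂_half_term, mul_add, mul_one, Complex.exp_add, mul_comm, ← Complex.exp_pi_mul_I,
    ← Complex.exp_int_mul]
  congr 1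
  -- The sign is e^{πin²} = e^{πin} because n² and n have the same parity.
  obtain ⟨k, hk⟩ : (2 : ℤ) ∣ n ^ 2 - n := by
    rw [sq, show n * n - n = (n - 1) * (n - 1 + 1) by ring]
    exact (Int.even_mul_succ_self _).two_dvd
  rw [Complex.exp_eq_exp_iff_exists_int]
  refine ⟨k, ?_⟩
  have hk' : (n : ℂ) ^ 2 = n + 2 * k := by
    have := congrArg (Int.cast : ℤ → ℂ) hk
    push_cast at this
    linear_combination this
  rw [hk']
  ring

theorem thetaFour_add_one (z : ℂ) : thetaFour (z + 1) = jacobiTheta z := by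
  rw [← jacobiTheta_add_one, show z + 1 + 1 = 2 + z by ring, jacobiTheta_two_add]

/-- Taking fourth powers removes the square-root branch from the theta functional equation. -/
theorem cpow_half_pow_four (w : ℂ) : (w ^ (1 / 2 : ℂ)) ^ 4 = w ^ 2 := by
  rw [← Complex.cpow_nat_mul, show ((4 : ℕ) : ℂ) * (1 / 2) = (2 : ℕ) by norm_num,
    Complex.cpow_natCast]

theorem jacobiTheta_neg_inv_pow_four {z : ℂ} (hz : z ≠ 0) :
    jacobiTheta (-1 / z) ^ 4 = -z ^ 2 * jacobiTheta z ^ 4 := by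
  have h := congrArg (· ^ 4) (jacobiTheta₂_functional_equation 0 z)
  simp only [mul_pow, div_pow, one_pow, cpow_half_pow_four, zero_div] at h
  rw [jacobiTheta_eq_jacobiTheta₂, jacobiTheta_eq_jacobiTheta₂, h]
  simp
  field_simp

/-- The functional equation at the half period z/2 produces the argument 1/2 on the other side; its
Gaussian factor cancels the prefactor of `thetaTwo_eq`. -/
theorem thetaFour_neg_inv_pow_four {z : ℂ} (hz : z ≠ 0) :
    thetaFour (-1 / z) ^ 4 = -z ^ 2 * thetaTwo z ^ 4 := by
  have h := congrArg (· ^ 4) (jacobiTheta₂_functional_equation (z / 2) z)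
  simp only [mul_pow, div_pow, one_pow, cpow_half_pow_four] at h
  have he : cexp (π * I * z / 4) * cexp (-π * I * (z ^ 2 / 2 ^ 2) / z) = 1 := by
    rw [← Complex.exp_add, ← Complex.exp_zero]
    congr 1
    field_simp
    ring
  rw [thetaTwo_eq, mul_pow, h, show z / 2 / z = 1 / 2 by field_simp, thetaFour,
    show ∀ a b c d e : ℂ, a * (b ^ 4 * (c * d ^ 4 * e)) = a * c * (b * d) ^ 4 * e by intros; ring,
    he, neg_sq, I_sq]
  field_simp

theorem tendsto_jacobiTheta : Tendsto jacobiTheta (comap im atTop) (𝓝 1) := by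
  have h := isBigO_at_im_infty_jacobiTheta_sub_one.trans_tendsto
    (((Real.tendsto_exp_atBot).comp (tendsto_id.const_mul_atTop_of_neg
      (neg_lt_zero.2 Real.pi_pos))).comp tendsto_comap)
  simpa using h.add_const 1

theorem theta3_eq {z : ℂ} (hz : 0 < z.im) : theta3 (2 * (π * I * z)) = jacobiTheta z := by
  rw [theta3, jacobiTheta_eq_tsum_nat hz, tsum_pnat_eq_tsum_succ
    (f := fun k : ℕ => cexp ((k : ℂ) ^ 2 / 2 * (2 * (π * I * z))))]
  congr 2
  refine tsum_congr fun n => ?_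
  push_cast
  ring_nf

theorem theta2_eq {z : ℂ} (hz : 0 < z.im) : theta2 (2 * (π * I * z)) = thetaTwo z := by
  have hs := summable_thetaTwo_term hz
  have h1 (n : ℕ) : cexp (1 / 2 * ((n : ℂ) + 1 / 2) ^ 2 * (2 * (π * I * z))) =
      cexp (π * I * (((n : ℤ) : ℂ) + 1 / 2) ^ 2 * z) := by
    push_cast
    ring_nf
  -- The indices n and -(n + 1) give equal terms, which accounts for the factor 2 in `theta2`.
  have h2 (n : ℕ) : cexp (1 / 2 * ((n : ℂ) + 1 / 2) ^ 2 * (2 * (π * I * z))) =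
      cexp (π * I * (((-(n + 1) : ℤ) : ℂ) + 1 / 2) ^ 2 * z) := by
    push_cast
    ring_nf
  have hs1 : Summable fun n : ℕ => cexp (π * I * (((n : ℤ) : ℂ) + 1 / 2) ^ 2 * z) :=
    hs.comp_injective (i := ((↑) : ℕ → ℤ)) Nat.cast_injective
  have hs2 : Summable fun n : ℕ => cexp (π * I * (((-(n + 1) : ℤ) : ℂ) + 1 / 2) ^ 2 * z) :=
    hs1.congr fun n => (h1 n).symm.trans (h2 n)
  rw [theta2, thetaTwo, tsum_of_nat_of_neg_add_one
    (f := fun n : ℤ => cexp (π * I * ((n : ℂ) + 1 / 2) ^ 2 * z)) hs1 hs2, two_mul,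
    ← tsum_congr h1, ← tsum_congr h2]

theorem tendsto_thetaFour : Tendsto thetaFour (comap im atTop) (𝓝 1) := by
  have h : Tendsto (fun z : ℂ => z + 1) (comap im atTop) (comap im atTop) := by
    rw [tendsto_comap_iff]
    exact tendsto_comap.congr fun z => by simp
  exact (tendsto_jacobiTheta.comp h).congr jacobiTheta_add_one

/-! ### Lambert series and E₂. -/

theorem summable_lambert {q : ℂ} (hq : ‖q‖ < 1) :
    Summable fun k : ℕ => (k : ℂ) * q ^ k / (1 - q ^ k) := by
  simpa using summable_norm_pow_mul_geometric_div_one_sub 1 hq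

theorem E2_eq_tsum_nat {q : ℂ} (hq : ‖q‖ < 1) :
    E2 q = 1 - 24 * ∑' k : ℕ, (k : ℂ) * q ^ k / (1 - q ^ k) := by
  -- The added term k = 0 has denominator 0 and equals 0.
  rw [E2, ← tsum_zero_pnat_eq_tsum_nat (summable_lambert hq)]
  simp

theorem summable_lambert_odd {q : ℂ} (hq : ‖q‖ < 1) :
    Summable fun k : ℕ => ((2 * k + 1 : ℕ) : ℂ) * q ^ (2 * k + 1) / (1 - q ^ (2 * k + 1)) :=
  (summable_lambert hq).comp_injective (i := fun k => 2 * k + 1) fun a b h => by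
    simpa using h

theorem tsum_lambert_even_add_odd {q : ℂ} (hq : ‖q‖ < 1) :
    ∑' k : ℕ, (k : ℂ) * q ^ k / (1 - q ^ k) =
      ∑' k : ℕ, ((2 * k : ℕ) : ℂ) * q ^ (2 * k) / (1 - q ^ (2 * k)) +
      ∑' k : ℕ, ((2 * k + 1 : ℕ) : ℂ) * q ^ (2 * k + 1) / (1 - q ^ (2 * k + 1)) :=
  (tsum_even_add_odd (f := fun k : ℕ => (k : ℂ) * q ^ k / (1 - q ^ k))
    ((summable_lambert hq).comp_injective (i := fun k => 2 * k) fun a b h => by simpa using h)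
    (summable_lambert_odd hq)).symm

theorem tsum_lambert_even (q : ℂ) :
    ∑' k : ℕ, ((2 * k : ℕ) : ℂ) * q ^ (2 * k) / (1 - q ^ (2 * k)) =
      2 * ∑' k : ℕ, (k : ℂ) * (q ^ 2) ^ k / (1 - (q ^ 2) ^ k) := by
  rw [← tsum_mul_left]
  refine tsum_congr fun k => ?_
  rw [pow_mul]
  push_cast
  ring

theorem one_sub_pow_ne_zero_and_one_add_pow_ne_zero {q : ℂ} (hq : ‖q‖ < 1) {k : ℕ} (hk : k ≠ 0) :
    1 - q ^ k ≠ 0 ∧ 1 + q ^ k ≠ 0 := by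
  have h : ‖q ^ k‖ < 1 := by
    rw [norm_pow]
    exact pow_lt_one₀ (norm_nonneg q) hq hk
  constructor
  · intro h0
    rw [← sub_eq_zero.1 h0] at h
    simp at h
  · intro h0
    rw [eq_neg_of_add_eq_zero_right h0] at h
    simp at h

/-- Terms with even k agree for q and -q. For odd k, with x = q^k, x/(1 - x) - x/(1 + x) = 2x²/(1 -
x²), which leaves an odd-index Lambert series in q². -/
theorem E2_add_E2_neg {q : ℂ} (hq : ‖q‖ < 1) :
    E2 q + E2 (-q) = 6 * E2 (q ^ 2) - 4 * E2 (q ^ 4) := by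
  have hq' : ‖-q‖ < 1 := by rwa [norm_neg]
  have hq2 : ‖q ^ 2‖ < 1 := by
    rw [norm_pow]
    exact pow_lt_one₀ (norm_nonneg q) hq two_ne_zero
  have hq4 : ‖q ^ 4‖ < 1 := by
    rw [norm_pow]
    exact pow_lt_one₀ (norm_nonneg q) hq four_ne_zero
  have hodd : ∑' k : ℕ, ((2 * k + 1 : ℕ) : ℂ) * q ^ (2 * k + 1) / (1 - q ^ (2 * k + 1)) +
      ∑' k : ℕ, ((2 * k + 1 : ℕ) : ℂ) * (-q) ^ (2 * k + 1) / (1 - (-q) ^ (2 * k + 1)) =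
      2 * ∑' k : ℕ, ((2 * k + 1 : ℕ) : ℂ) * (q ^ 2) ^ (2 * k + 1) /
        (1 - (q ^ 2) ^ (2 * k + 1)) := by
    rw [← (summable_lambert_odd hq).tsum_add (summable_lambert_odd hq'), ← tsum_mul_left]
    refine tsum_congr fun k => ?_
    obtain ⟨h1, h2⟩ := one_sub_pow_ne_zero_and_one_add_pow_ne_zero hq (Nat.succ_ne_zero (2 * k))
    obtain ⟨h3, -⟩ := one_sub_pow_ne_zero_and_one_add_pow_ne_zero hq2 (Nat.succ_ne_zero (2 * k))
    rw [Nat.succ_eq_add_one] at h1 h2 h3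
    rw [← pow_mul, mul_comm 2 (2 * k + 1), pow_mul] at h3 ⊢
    rw [Odd.neg_pow ⟨k, rfl⟩, sub_neg_eq_add]
    field_simp
    ring
  have e1 := tsum_lambert_even_add_odd hq
  have e2 := tsum_lambert_even_add_odd hq'
  have e3 := tsum_lambert_even_add_odd hq2
  rw [tsum_lambert_even] at e1 e2 e3
  rw [neg_sq] at e2
  rw [← pow_mul] at e3
  rw [E2_eq_tsum_nat hq, E2_eq_tsum_nat hq', E2_eq_tsum_nat hq2, E2_eq_tsum_nat hq4]
  linear_combination -24 * e1 - 24 * e2 + 48 * e3 - 24 * hodd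

/-! ### E₂ on the upper half plane. -/

/-- `E₂` as a function of `z`, where `q = exp (2π i z)`. -/
noncomputable def E2Exp (z : ℂ) : ℂ := E2 (cexp (2 * π * I * z))

theorem norm_exp_lt_one {z : ℂ} (hz : 0 < z.im) : ‖cexp (2 * π * I * z)‖ < 1 := by
  simpa using UpperHalfPlane.norm_exp_two_pi_I_lt_one ⟨z, hz⟩

theorem E2Exp_coe (z : UpperHalfPlane) : E2Exp z = EisensteinSeries.E2 z := by
  rw [EisensteinSeries.E2_eq_tsum_cexp, E2Exp, E2,
    ← tsum_pow_div_one_sub_eq_tsum_sigma (norm_exp_lt_one z.im_pos)]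
  simp

theorem E2Exp_add_one (z : ℂ) : E2Exp (z + 1) = E2Exp z := by
  rw [E2Exp, E2Exp, mul_add, mul_one, Complex.exp_add, Complex.exp_two_pi_mul_I, mul_one]

theorem E2Exp_add_half {z : ℂ} (hz : 0 < z.im) :
    E2Exp (z + 1 / 2) = 6 * E2Exp (2 * z) - 4 * E2Exp (4 * z) - E2Exp z := by
  have h := E2_add_E2_neg (norm_exp_lt_one hz)
  have h1 : cexp (2 * π * I * (z + 1 / 2)) = -cexp (2 * π * I * z) := by
    rw [mul_add, show 2 * π * I * (1 / 2) = π * I by ring, Complex.exp_add, Complex.exp_pi_mul_I,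
      mul_neg_one]
  rw [E2Exp, E2Exp, E2Exp, E2Exp, h1, eq_sub_iff_add_eq, add_comm, h, ← Complex.exp_nat_mul,
    ← Complex.exp_nat_mul]
  push_cast
  ring_nf

/-- The value of c is irrelevant: the anomaly cancels in the combinations used later. -/
theorem exists_E2Exp_neg_inv :
    ∃ c : ℂ, ∀ z : ℂ, 0 < z.im → E2Exp (-1 / z) = z ^ 2 * E2Exp z + c * z := by
  refine ⟨-(1 / (2 * riemannZeta 2) * (2 * π * I)), fun z hz => ?_⟩
  have hz0 : z ≠ 0 := by
    rintro rfl
    simp at hz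
  have h := congrFun (EisensteinSeries.E2_slash_action ModularGroup.S) ⟨z, hz⟩
  rw [SlashInvariantForm.slash_S_apply, ← E2Exp_coe] at h
  simp only [Pi.sub_apply, Pi.smul_apply, EisensteinSeries.D2_S, ← E2Exp_coe, smul_eq_mul,
    inv_neg] at h
  rw [neg_div, one_div]
  have h2 : E2Exp (-z⁻¹) * z ^ (-2 : ℤ) = E2Exp z - 1 / (2 * riemannZeta 2) * (2 * π * I / z) := h
  have h3 : E2Exp (-z⁻¹) = z ^ 2 * (E2Exp (-z⁻¹) * z ^ (-2 : ℤ)) := by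
    rw [zpow_neg, zpow_ofNat]
    field_simp
  rw [h3, h2]
  field_simp
  ring

theorem differentiableOn_E2Exp : DifferentiableOn ℂ E2Exp {z | 0 < z.im} := by
  refine (UpperHalfPlane.mdifferentiable_iff.1 E2_mdifferentiable).congr fun z hz => ?_
  rw [Function.comp_apply, UpperHalfPlane.ofComplex_apply_of_im_pos hz, ← E2Exp_coe]

theorem tendsto_E2_zero : Tendsto E2 (𝓝 0) (𝓝 1) := by
  -- Dominating series on |q| < 1/2, where |1 - q^k| ≥ 1/2.
  have hb : Summable fun k : ℕ+ => (k : ℝ) * (1 / 2) ^ (k : ℕ) * 2 := by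
    have h := summable_pow_mul_geometric_of_norm_lt_one 1 (r := (1 / 2 : ℝ)) (by norm_num)
    simp only [pow_one] at h
    exact (h.comp_injective PNat.coe_injective).mul_right 2
  have ht (k : ℕ+) : Tendsto (fun q : ℂ => (k : ℂ) * q ^ (k : ℕ) / (1 - q ^ (k : ℕ))) (𝓝 0)
      (𝓝 0) := by
    have h : ContinuousAt (fun q : ℂ => (k : ℂ) * q ^ (k : ℕ) / (1 - q ^ (k : ℕ))) 0 :=
      ContinuousAt.div (by fun_prop) (by fun_prop) (by simp)
    simpa [ContinuousAt] using h
  have h := tendsto_tsum_of_dominated_convergence hb ht (by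
    filter_upwards [Metric.ball_mem_nhds (0 : ℂ) (by norm_num : (0 : ℝ) < 1 / 2)] with q hq k
    have hq' : ‖q ^ (k : ℕ)‖ ≤ (1 / 2) ^ (k : ℕ) := by
      rw [norm_pow]
      exact pow_le_pow_left₀ (norm_nonneg q) (mem_ball_zero_iff.1 hq).le _
    have hk : (1 / 2 : ℝ) ^ (k : ℕ) ≤ 1 / 2 :=
      pow_le_of_le_one (by norm_num) (by norm_num) k.ne_zero
    have hd : 1 / 2 ≤ ‖1 - q ^ (k : ℕ)‖ := by
      have := norm_sub_norm_le 1 (q ^ (k : ℕ))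
      rw [norm_one] at this
      linarith
    rw [norm_div, norm_mul, Complex.norm_natCast, div_le_iff₀ (by linarith)]
    have : (k : ℝ) * ‖q ^ (k : ℕ)‖ ≤ k * (1 / 2) ^ (k : ℕ) := by gcongr
    have h0 : 0 ≤ (k : ℝ) * (1 / 2) ^ (k : ℕ) := by positivity
    nlinarith)
  have h1 := (h.const_mul 24).const_sub 1
  simp only [tsum_zero, mul_zero, sub_zero] at h1
  exact h1

theorem tendsto_E2Exp : Tendsto E2Exp (comap im atTop) (𝓝 1) := by
  have hq : Tendsto (fun z : ℂ => cexp (2 * π * I * z)) (comap im atTop) (𝓝 0) := by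
    rw [tendsto_zero_iff_norm_tendsto_zero]
    have h : Tendsto (fun y : ℝ => Real.exp (-(2 * π) * y)) atTop (𝓝 0) :=
      Real.tendsto_exp_atBot.comp (tendsto_id.const_mul_atTop_of_neg (by simp [Real.pi_pos]))
    refine (h.comp tendsto_comap).congr fun z => ?_
    simp [Complex.norm_exp]
  exact tendsto_E2_zero.comp hq

theorem tendsto_mul_comap_im {r : ℝ} (hr : 0 < r) :
    Tendsto (fun z : ℂ => (r : ℂ) * z) (comap im atTop) (comap im atTop) := by
  rw [tendsto_comap_iff]
  exact ((tendsto_id.const_mul_atTop hr).comp tendsto_comap).congr fun z => by simp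

/-! ### Vanishing criterion in level one. -/

open ModularForm MatrixGroups in
/-- A holomorphic function on the upper half plane with the transformation law of a modular form
of level one and weight less than `12` vanishes if it tends to zero at `i∞`. -/
theorem eq_zero_of_levelOne_of_tendsto_zero {F : ℂ → ℂ} {k : ℤ} (hk : k < 12)
    (hd : DifferentiableOn ℂ F {z | 0 < z.im}) (hT : ∀ z : ℂ, 0 < z.im → F (z + 1) = F z)
    (hS : ∀ z : ℂ, 0 < z.im → F (-1 / z) = z ^ k * F z)
    (h0 : Tendsto F (comap im atTop) (𝓝 0)) {z : ℂ} (hz : 0 < z.im) : F z = 0 := by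
  have hS' : (fun z : UpperHalfPlane => F z) ∣[k] ModularGroup.S = fun z : UpperHalfPlane => F z := by
    ext z
    have h : F (-(z : ℂ))⁻¹ = (z : ℂ) ^ k * F z := by
      rw [← hS z z.im_pos, neg_div, one_div, inv_neg]
    rw [SlashInvariantForm.slash_S_apply]
    change F (-(z : ℂ))⁻¹ * (z : ℂ) ^ (-k) = F z
    rw [h, mul_right_comm, zpow_neg, mul_inv_cancel₀ (zpow_ne_zero _ z.ne_zero), one_mul]
  have hT' : (fun z : UpperHalfPlane => F z) ∣[k] ModularGroup.T = fun z : UpperHalfPlane => F z := by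
    ext z
    have hden : UpperHalfPlane.denom (ModularGroup.T : GL (Fin 2) ℝ) z = 1 := by
      rw [ModularGroup.denom_apply]
      simp [ModularGroup.T]
    rw [SL_slash_apply, UpperHalfPlane.modular_T_smul, hden, one_zpow, mul_one]
    simpa [add_comm] using hT z z.im_pos
  have hγ := SlashInvariantForm.slash_action_generators_SL2Z hS' hT'
  let f : CuspForm 𝒮ℒ k :=
    { toFun := fun z => F z
      slash_action_eq' := by
        rintro _ ⟨γ, rfl⟩
        exact hγ γ
      holo' := by
        rw [UpperHalfPlane.mdifferentiable_iff]
        exact hd.congr fun z hz => by simp [UpperHalfPlane.ofComplex_apply_of_im_pos hz]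
      zero_at_cusps' := fun {c} hc => by
        rw [Subgroup.IsArithmetic.isCusp_iff_isCusp_SL2Z] at hc
        rw [OnePoint.isZeroAt_iff_forall_SL2Z hc]
        intro γ _
        -- By invariance, the condition at every cusp reduces to the limit at i∞.
        rw [hγ γ]
        refine h0.comp ?_
        rw [tendsto_comap_iff]
        exact tendsto_comap }
  have hf : f = 0 := rank_zero_iff_forall_zero.1 (CuspForm.rank_eq_zero_of_weight_lt_twelve hk) f
  exact DFunLike.congr_fun hf ⟨z, hz⟩

/-! ### Fourth powers of theta constants as Eisenstein series. -/

/-- The difference between `θ₃⁴` and the Eisenstein series that represents it. -/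
noncomputable def thetaDefect (z : ℂ) : ℂ :=
  jacobiTheta z ^ 4 - (4 * E2Exp (2 * z) - E2Exp (1 / 2 * z)) / 3

/-- The difference between `θ₄⁴` and the Eisenstein series that represents it. -/
noncomputable def thetaFourDefect (z : ℂ) : ℂ :=
  thetaFour z ^ 4 - (8 * E2Exp (2 * z) + E2Exp (1 / 2 * z) - 6 * E2Exp z) / 3

theorem E2Exp_add_two (z : ℂ) : E2Exp (z + 2) = E2Exp z := by
  rw [← E2Exp_add_one z, ← E2Exp_add_one (z + 1)]
  ring_nf

theorem thetaDefect_add_one {z : ℂ} (hz : 0 < z.im) :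
    thetaDefect (z + 1) = thetaFourDefect z := by
  have h := E2Exp_add_half (z := 1 / 2 * z) (by simpa using hz)
  rw [show 2 * (1 / 2 * z) = z by ring, show 4 * (1 / 2 * z) = 2 * z by ring] at h
  rw [thetaDefect, thetaFourDefect, jacobiTheta_add_one, mul_add, mul_add, mul_one, mul_one,
    E2Exp_add_two, h]
  ring

theorem thetaFourDefect_add_one {z : ℂ} (hz : 0 < z.im) :
    thetaFourDefect (z + 1) = thetaDefect z := by
  have h := E2Exp_add_half (z := 1 / 2 * z) (by simpa using hz)
  rw [show 2 * (1 / 2 * z) = z by ring, show 4 * (1 / 2 * z) = 2 * z by ring] at h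
  rw [thetaDefect, thetaFourDefect, thetaFour_add_one, mul_add, mul_add, mul_one, mul_one,
    E2Exp_add_two, h, E2Exp_add_one]
  ring

theorem exists_E2Exp_neg_inv_mul : ∃ c : ℂ, ∀ z : ℂ, 0 < z.im →
    E2Exp (-1 / z) = z ^ 2 * E2Exp z + c * z ∧
    E2Exp (2 * (-1 / z)) = z ^ 2 / 4 * E2Exp (1 / 2 * z) + c * z / 2 ∧
    E2Exp (1 / 2 * (-1 / z)) = 4 * z ^ 2 * E2Exp (2 * z) + 2 * c * z := by
  obtain ⟨c, hc⟩ := exists_E2Exp_neg_inv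
  refine ⟨c, fun z hz => ⟨hc z hz, ?_, ?_⟩⟩
  · rw [show 2 * (-1 / z) = -1 / (1 / 2 * z) by field_simp, hc _ (by simpa using hz)]
    ring
  · rw [show 1 / 2 * (-1 / z) = -1 / (2 * z) by field_simp, hc _ (by simpa using hz)]
    ring

theorem thetaDefect_neg_inv {z : ℂ} (hz : 0 < z.im) :
    thetaDefect (-1 / z) = -z ^ 2 * thetaDefect z := by
  have hz0 : z ≠ 0 := by
    rintro rfl
    simp at hz
  obtain ⟨c, hc⟩ := exists_E2Exp_neg_inv_mul
  obtain ⟨-, h2, h3⟩ := hc z hz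
  rw [thetaDefect, thetaDefect, jacobiTheta_neg_inv_pow_four hz0, h2, h3]
  ring

/-- θ₄⁴ turns into θ₂⁴, which Jacobi's quartic identity rewrites as θ₃⁴ - θ₄⁴; this keeps the span
of the two defects stable. -/
theorem thetaFourDefect_neg_inv {z : ℂ} (hz : 0 < z.im) :
    thetaFourDefect (-1 / z) = -z ^ 2 * (thetaDefect z - thetaFourDefect z) := by
  have hz0 : z ≠ 0 := by
    rintro rfl
    simp at hz
  obtain ⟨c, hc⟩ := exists_E2Exp_neg_inv_mul
  obtain ⟨h1, h2, h3⟩ := hc z hz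
  rw [thetaFourDefect, thetaFourDefect, thetaDefect, thetaFour_neg_inv_pow_four hz0, h1, h2, h3,
    jacobiTheta_pow_four hz]
  ring

theorem differentiableOn_E2Exp_mul {r : ℝ} (hr : 0 < r) :
    DifferentiableOn ℂ (fun z => E2Exp (r * z)) {z | 0 < z.im} :=
  differentiableOn_E2Exp.comp (by fun_prop) fun z hz => by
    simpa using mul_pos hr hz

theorem differentiableOn_thetaDefect : DifferentiableOn ℂ thetaDefect {z | 0 < z.im} := by
  have h2 := differentiableOn_E2Exp_mul (r := 2) (by norm_num)
  have h3 := differentiableOn_E2Exp_mul (r := 1 / 2) (by norm_num)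
  have hj : DifferentiableOn ℂ jacobiTheta {z | 0 < z.im} :=
    fun z hz => (differentiableAt_jacobiTheta hz).differentiableWithinAt
  push_cast at h2 h3
  exact (hj.pow 4).sub (((h2.const_mul 4).sub h3).div_const 3)

theorem differentiableOn_thetaFourDefect : DifferentiableOn ℂ thetaFourDefect {z | 0 < z.im} := by
  have h2 := differentiableOn_E2Exp_mul (r := 2) (by norm_num)
  have h3 := differentiableOn_E2Exp_mul (r := 1 / 2) (by norm_num)
  have hj : DifferentiableOn ℂ thetaFour {z | 0 < z.im} :=
    fun z hz => (differentiableAt_jacobiTheta₂_snd (1 / 2) hz).differentiableWithinAt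
  push_cast at h2 h3
  exact (hj.pow 4).sub ((((h2.const_mul 8).add h3).sub
    (differentiableOn_E2Exp.const_mul 6)).div_const 3)

theorem tendsto_thetaDefect : Tendsto thetaDefect (comap im atTop) (𝓝 0) := by
  have h2 := tendsto_E2Exp.comp (tendsto_mul_comap_im (r := 2) (by norm_num))
  have h3 := tendsto_E2Exp.comp (tendsto_mul_comap_im (r := 1 / 2) (by norm_num))
  have h := (tendsto_jacobiTheta.pow 4).sub (((h2.const_mul 4).sub h3).div_const 3)
  norm_num at h
  refine h.congr fun z => ?_
  simp [thetaDefect]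

theorem tendsto_thetaFourDefect : Tendsto thetaFourDefect (comap im atTop) (𝓝 0) := by
  have h2 := tendsto_E2Exp.comp (tendsto_mul_comap_im (r := 2) (by norm_num))
  have h3 := tendsto_E2Exp.comp (tendsto_mul_comap_im (r := 1 / 2) (by norm_num))
  have h := (tendsto_thetaFour.pow 4).sub ((((h2.const_mul 8).add h3).sub
    (tendsto_E2Exp.const_mul 6)).div_const 3)
  norm_num at h
  refine h.congr fun z => ?_
  simp [thetaFourDefect]

theorem thetaDefect_sq_sub_mul_add_sq {z : ℂ} (hz : 0 < z.im) :
    thetaDefect z ^ 2 - thetaDefect z * thetaFourDefect z + thetaFourDefect z ^ 2 = 0 := by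
  refine eq_zero_of_levelOne_of_tendsto_zero (k := 4)
    (F := fun z => thetaDefect z ^ 2 - thetaDefect z * thetaFourDefect z + thetaFourDefect z ^ 2)
    (by norm_num) ?_ ?_ ?_ ?_ hz
  · exact ((differentiableOn_thetaDefect.pow 2).sub
      (differentiableOn_thetaDefect.mul differentiableOn_thetaFourDefect)).add
      (differentiableOn_thetaFourDefect.pow 2)
  · intro z hz
    simp only [thetaDefect_add_one hz, thetaFourDefect_add_one hz]
    ring
  · intro z hz
    simp only [thetaDefect_neg_inv hz, thetaFourDefect_neg_inv hz, zpow_ofNat]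
    ring
  · simpa using ((tendsto_thetaDefect.pow 2).sub
      (tendsto_thetaDefect.mul tendsto_thetaFourDefect)).add (tendsto_thetaFourDefect.pow 2)

/-- If `θ₃⁴ - E = w (θ₄⁴ - E')` with a constant `w` such that `w² ≠ 1`, then `θ₄⁴ = E'`. -/
theorem thetaFourDefect_eq_zero_of_proportional {w : ℂ} (hw : w ^ 2 ≠ 1)
    (h : ∀ z : ℂ, 0 < z.im → thetaDefect z - w * thetaFourDefect z = 0) {z : ℂ} (hz : 0 < z.im) :
    thetaFourDefect z = 0 := by
  have h1 := h z hz
  have h2 := h (z + 1) (by simpa using hz)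
  rw [thetaDefect_add_one hz, thetaFourDefect_add_one hz] at h2
  have h3 : (1 - w ^ 2) * thetaFourDefect z = 0 := by linear_combination w * h1 + h2
  exact (mul_eq_zero.1 h3).resolve_left (sub_ne_zero.2 hw.symm)

theorem thetaFourDefect_eq_zero {z : ℂ} (hz : 0 < z.im) : thetaFourDefect z = 0 := by
  obtain ⟨s, hs⟩ := IsAlgClosed.exists_pow_nat_eq (-3 : ℂ) two_pos
  have hne (w : ℂ) (hw : w ^ 2 - w + 1 = 0) : w ^ 2 ≠ 1 := by
    intro h1
    have h2 : w = 2 := by linear_combination h1 - hw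
    rw [h2] at h1
    norm_num at h1
  have hopen : IsOpen {z : ℂ | 0 < z.im} := isOpen_lt continuous_const continuous_im
  have hconn : IsPreconnected {z : ℂ | 0 < z.im} := (convex_halfSpace_im_gt 0).isPreconnected
  have hw (w : ℂ) : AnalyticOnNhd ℂ (fun z => thetaDefect z - w * thetaFourDefect z)
      {z | 0 < z.im} :=
    (differentiableOn_thetaDefect.sub
      (differentiableOn_thetaFourDefect.const_mul w)).analyticOnNhd hopen
  -- With s² = -3, the quadratic form is the product of these two linear factors; by analyticity on
  -- a connected domain one factor vanishes identically.
  rcases (hw ((1 + s) / 2)).eq_zero_or_eq_zero_of_mul_eq_zero (hw ((1 - s) / 2)) (fun z hz => by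
    linear_combination thetaDefect_sq_sub_mul_add_sq hz - thetaFourDefect z ^ 2 / 4 * hs) hconn
    with h | h
  · exact thetaFourDefect_eq_zero_of_proportional
      (hne _ (by linear_combination hs / 4)) h hz
  · exact thetaFourDefect_eq_zero_of_proportional
      (hne _ (by linear_combination hs / 4)) h hz

/-- Jacobi's four-square theorem for `θ₄`. -/
theorem thetaFour_pow_four {z : ℂ} (hz : 0 < z.im) :
    thetaFour z ^ 4 = (8 * E2Exp (2 * z) + E2Exp (1 / 2 * z) - 6 * E2Exp z) / 3 :=
  sub_eq_zero.1 (thetaFourDefect_eq_zero hz)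

/-- Jacobi's four-square theorem. -/
theorem jacobiTheta_pow_four_eq {z : ℂ} (hz : 0 < z.im) :
    jacobiTheta z ^ 4 = (4 * E2Exp (2 * z) - E2Exp (1 / 2 * z)) / 3 := by
  have h := thetaFourDefect_eq_zero (z := z + 1) (by simpa using hz)
  rw [thetaFourDefect_add_one hz] at h
  exact sub_eq_zero.1 h

/-! ### Return to the variable t. -/

theorem exists_eq_pi_mul_I_mul {t : ℂ} (ht : t.re < 0) :
    ∃ z : ℂ, 0 < z.im ∧ t = π * I * z := by
  have hπ : (π : ℂ) ≠ 0 := ofReal_ne_zero.2 Real.pi_ne_zero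
  refine ⟨((π⁻¹ : ℝ) : ℂ) * (-I * t), ?_, ?_⟩
  · rw [im_ofReal_mul]
    have : (-I * t).im = -t.re := by simp
    rw [this]
    exact mul_pos (inv_pos.2 Real.pi_pos) (neg_pos.2 ht)
  · push_cast
    field_simp
    rw [I_sq]
    ring

/-- With t = πiz, e^t is the nome, so E₂(e^t) is `E2Exp` at z/2; hence the arguments z/2 and 2z in
the defects. -/
theorem theta3_two_mul_pow_four {t : ℂ} (ht : t.re < 0) :
    theta3 (2 * t) ^ 4 = (4 * E2 (cexp t ^ 4) - E2 (cexp t)) / 3 := by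
  obtain ⟨z, hz, rfl⟩ := exists_eq_pi_mul_I_mul ht
  rw [theta3_eq hz, jacobiTheta_pow_four_eq hz, E2Exp, E2Exp, ← Complex.exp_nat_mul]
  push_cast
  ring_nf

theorem theta2_two_mul_pow_four {t : ℂ} (ht : t.re < 0) :
    theta2 (2 * t) ^ 4 = (6 * E2 (cexp t ^ 2) - 4 * E2 (cexp t ^ 4) - 2 * E2 (cexp t)) / 3 := by
  obtain ⟨z, hz, rfl⟩ := exists_eq_pi_mul_I_mul ht
  rw [theta2_eq hz, eq_sub_of_add_eq (jacobiTheta_pow_four hz).symm, jacobiTheta_pow_four_eq hz,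
    thetaFour_pow_four hz, E2Exp, E2Exp, E2Exp, ← Complex.exp_nat_mul, ← Complex.exp_nat_mul]
  push_cast
  ring_nf

theorem theta3_two_mul_sq {t : ℂ} (ht : t.re < 0) :
    theta3 (2 * t) ^ 2 = theta3 (4 * t) ^ 2 + theta2 (4 * t) ^ 2 := by
  obtain ⟨z, hz, rfl⟩ := exists_eq_pi_mul_I_mul ht
  have hz2 : 0 < (2 * z).im := by simpa using hz
  rw [show 4 * (π * I * z) = 2 * (π * I * (2 * z)) by ring, theta3_eq hz, theta3_eq hz2,
    theta2_eq hz2, jacobiTheta_sq hz]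

theorem theta2_two_mul_sq {t : ℂ} (ht : t.re < 0) :
    theta2 (2 * t) ^ 2 = 2 * (theta3 (4 * t) * theta2 (4 * t)) := by
  obtain ⟨z, hz, rfl⟩ := exists_eq_pi_mul_I_mul ht
  have hz2 : 0 < (2 * z).im := by simpa using hz
  rw [show 4 * (π * I * z) = 2 * (π * I * (2 * z)) by ring, theta2_eq hz, theta3_eq hz2,
    theta2_eq hz2, thetaTwo_sq hz]

theorem summable_theta2 {t : ℂ} (ht : t.re < 0) :
    Summable fun k : ℕ => cexp ((1 / 2 : ℂ) * ((k : ℂ) + 1 / 2) ^ 2 * t) := by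
  obtain ⟨z, hz, rfl⟩ := exists_eq_pi_mul_I_mul ht
  have h : Summable fun k : ℕ => cexp (π * I * (((k : ℤ) : ℂ) + 1 / 2) ^ 2 * (1 / 2 * z)) :=
    (summable_thetaTwo_term (z := 1 / 2 * z) (by simpa using hz)).comp_injective
      (i := ((↑) : ℕ → ℤ)) Nat.cast_injective
  refine h.congr fun k => ?_
  push_cast
  ring_nf

theorem summable_theta3 {t : ℂ} (ht : t.re < 0) :
    Summable fun k : ℕ+ => cexp ((k : ℂ) ^ 2 / 2 * t) := by
  obtain ⟨z, hz, rfl⟩ := exists_eq_pi_mul_I_mul ht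
  have h : Summable fun k : ℕ+ => cexp (π * I * (((k : ℕ) : ℤ) : ℂ) ^ 2 * (1 / 2 * z)) :=
    (summable_jacobiTheta_term (z := 1 / 2 * z) (by simpa using hz)).comp_injective
      (i := fun k : ℕ+ => ((k : ℕ) : ℤ)) fun a b hab => by simpa using hab
  refine h.congr fun k => ?_
  push_cast
  ring_nf

end QuasimodularIdentities

theorem mainTheorem6 :
    -- the series that define `E₂`, `θ₂`, `θ₃` converge absolutely
    (∀ q : ℂ, ‖q‖ < 1 →
      Summable (fun k : ℕ+ => (k : ℂ) * q ^ (k : ℕ) / (1 - q ^ (k : ℕ)))) ∧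
    (∀ t : ℂ, t.re < 0 →
      Summable (fun k : ℕ => Complex.exp ((1 / 2 : ℂ) * ((k : ℂ) + 1 / 2) ^ 2 * t)) ∧
      Summable (fun k : ℕ+ => Complex.exp ((k : ℂ) ^ 2 / 2 * t))) ∧
    (∀ t q : ℂ, t.re < 0 → q = Complex.exp t →
      -- the identities of the pair `(Ẽ₇, G^D)`
      (1 / 4 : ℂ) * QuasimodularIdentities.f1 (q ^ 4) =
          (1 / 384 : ℂ) * (-3 * QuasimodularIdentities.wFun q
            - QuasimodularIdentities.xFun t ^ 2 - QuasimodularIdentities.yFun t ^ 2) ∧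
      QuasimodularIdentities.f0 (q ^ 4) = (1 / 16 : ℂ) * QuasimodularIdentities.yFun t ^ 2 ∧
      QuasimodularIdentities.f2 (q ^ 4) =
          (3 / 32 : ℂ) * (-QuasimodularIdentities.wFun q
            + QuasimodularIdentities.xFun t ^ 2 - QuasimodularIdentities.yFun t ^ 2) ∧
      QuasimodularIdentities.E2 q - QuasimodularIdentities.E2 (-q) =
          -3 * QuasimodularIdentities.theta2 (2 * t) ^ 4 ∧
      QuasimodularIdentities.E2 (q ^ 2) =
          (1 / 2 : ℂ) * QuasimodularIdentities.E2 q
            + (1 / 2 : ℂ) * QuasimodularIdentities.theta2 (2 * t) ^ 4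
            + (1 / 2 : ℂ) * QuasimodularIdentities.theta3 (2 * t) ^ 4 ∧
      -- the identities of the pair `(Ẽ₇, K₂)`
      QuasimodularIdentities.theta2 (16 * t) ^ 2 + QuasimodularIdentities.theta3 (16 * t) ^ 2 =
          QuasimodularIdentities.theta3 (8 * t) ^ 2 ∧
      QuasimodularIdentities.theta2 (8 * t) ^ 5 =
          4 * QuasimodularIdentities.theta2 (8 * t) * QuasimodularIdentities.theta2 (16 * t) ^ 2
            * QuasimodularIdentities.theta3 (16 * t) ^ 2 ∧
      QuasimodularIdentities.theta2 (8 * t) ^ 4 =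
          4 * QuasimodularIdentities.theta2 (16 * t) ^ 2
            * QuasimodularIdentities.theta3 (16 * t) ^ 2) := by
  refine ⟨fun q hq => (QuasimodularIdentities.summable_lambert hq).comp_injective
      PNat.coe_injective, fun t ht => ⟨QuasimodularIdentities.summable_theta2 ht,
      QuasimodularIdentities.summable_theta3 ht⟩, ?_⟩
  rintro t q ht rfl
  have ht4 : (4 * t).re < 0 := by
    simp only [Complex.mul_re, Complex.re_ofNat, Complex.im_ofNat]
    linarith
  have hq : ‖Complex.exp t‖ < 1 := by rwa [Complex.norm_exp, Real.exp_lt_one_iff]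
  have hq4 : ‖Complex.exp t ^ 4‖ < 1 := by
    rw [norm_pow]
    exact pow_lt_one₀ (norm_nonneg _) hq four_ne_zero
  have he : Complex.exp (4 * t) = Complex.exp t ^ 4 := by
    rw [← Complex.exp_nat_mul]
    norm_num
  have e1 := QuasimodularIdentities.E2_add_E2_neg hq
  have e2 := QuasimodularIdentities.E2_add_E2_neg hq4
  have a2 := QuasimodularIdentities.theta2_two_mul_pow_four ht
  have a3 := QuasimodularIdentities.theta3_two_mul_pow_four ht
  have b2 := QuasimodularIdentities.theta2_two_mul_pow_four ht4
  have b3 := QuasimodularIdentities.theta3_two_mul_pow_four ht4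
  have c2 := QuasimodularIdentities.theta2_two_mul_sq ht4
  have c3 := QuasimodularIdentities.theta3_two_mul_sq ht4
  rw [he] at b2 b3
  rw [show 2 * (4 * t) = 8 * t by ring] at b2 b3 c2 c3
  rw [show 4 * (4 * t) = 16 * t by ring] at c2 c3
  simp only [← pow_mul, Nat.reduceMul] at b2 b3 e2
  have hy : QuasimodularIdentities.theta2 (8 * t) ^ 4 =
      4 * QuasimodularIdentities.theta2 (16 * t) ^ 2 *
        QuasimodularIdentities.theta3 (16 * t) ^ 2 := by
    -- Squaring `c2`, by a² - b² = (a + b)(a - b).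
    linear_combination (QuasimodularIdentities.theta2 (8 * t) ^ 2 + 2 *
      (QuasimodularIdentities.theta3 (16 * t) * QuasimodularIdentities.theta2 (16 * t))) * c2
  simp only [QuasimodularIdentities.f0, QuasimodularIdentities.f1, QuasimodularIdentities.f2,
    QuasimodularIdentities.wFun, QuasimodularIdentities.xFun, QuasimodularIdentities.yFun,
    ← pow_mul, Nat.reduceMul]
  refine ⟨?_, ?_, ?_, ?_, ?_, ?_, ?_, hy⟩
  -- The first three identities use the relations at q⁴, the next two those at q.
  · linear_combination (b2 + b3) / 384
  · linear_combination -b2 / 16 + e2 / 48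
  · linear_combination 3 / 32 * b2 - 3 / 32 * b3 - e2 / 48
  · linear_combination 3 * a2 - e1
  · linear_combination -(a2 + a3) / 2
  · rw [c3, add_comm]
  · linear_combination QuasimodularIdentities.theta2 (8 * t) * hy
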